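/- **Setup.** Let $\mathcal Z$ be a measurable space (data), $\mathcal W$ a nonempty standard Borel space (hypotheses), and $\ell:\mathcal W\times\mathcal Z\to[0,1]$ a measurable loss. Let $L$ be the depth and let $n_1,\dots,n_L\ge 1$ be the branching factors of a tree, so that there are $N_l=\prod_{k=1}^{l}n_k$ nodes of depth $l$, indexed by $i_{1:l}=(i_1,\dots,i_l)$ with $1\le i_k\le n_k$. A node of depth $L$ is a data point in $\mathcal Z$, and a node of depth $l<L$ is a probability measure on the space of nodes of depth $l+1$ (spaces of probability measures carry the $\sigma$-algebra generated by the evaluations on measurable sets). The root is a fixed meta-distribution $D$ on the space of nodes of depth $1$. *Dataset.* The random dataset $\mu=(\mu_l^{i_{1:l}})_{1\le l\le L}$ is sampled along the tree: $\mu_1^{i_1}\sim D$ i.i.d., and, recursively, the children of each node are i.i.d. from that node, independently for different nodes: $\mu_{l}^{i_{1:l}}\sim\mu_{l-1}^{i_{1:l-1}}$. A learning algorithm is a Markov kernel $P_{W|\mu}$ from the whole dataset (all nodes) to $\mathcal W$. With $$\hat L(w,\mu)=\frac1{N_L}\sum_{i_{1:L}}\ell(w,\mu_L^{i_{1:L}}),\qquad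 L(w)=\mathbb E_{\mu_L\sim\mu_{L-1}\sim\cdots\sim\mu_1\sim D}[\ell(w,\mu_L)],$$ the expected generalization error is $\mathrm{gen}(P_{W|\mu})=\mathbb E_{\mu}\,\mathbb E_{W\sim P_{W|\mu}}[L(W)-\hat L(W,\mu)]$. *Supersample.* To each node position $i_{1:l}$, $1\le l\le L$, attach a selection variable $U_l^{i_{1:l}}$, uniform on $\{1,2\}$, drawn independently of everything generated before and at the other positions, and a pair $\tilde\mu_l^{i_{1:l}}=(\mu_{l,1}^{i_{1:l}},\mu_{l,2}^{i_{1:l}})$ drawn i.i.d. from the selected parent $\mu_{l-1,U_{l-1}}^{i_{1:l-1}}$ (from $D$ if $l=1$), conditionally independently of the pairs and the selection variables already generated and of those at the other positions of depth $l$. The selected nodes $\mu_l^{i_{1:l}}=\mu_{l,U_l}^{i_{1:l}}$ form the dataset, and $W\sim P_{W|\mu}$ is the output of the algorithm on the selected dataset. For a value $m$ of $\tilde\mu_l^{i_{1:l}}$ write $$I(W;U_l^{i_{1:l}}\mid\tilde\mu_l^{i_{1:l}}=m)=D_{KL}\bigl(P_{W,U_l^{i_{1:l}}\mid\tilde\mu_l^{i_{1:l}}=m}\,\big\|\,P_{W\mid\tilde\mu_l^{i_{1:l}}=m}\otimes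 P_{U_l^{i_{1:l}}\mid\tilde\mu_l^{i_{1:l}}=m}\bigr)$$ (natural logarithm, regular conditional distributions), and let $I(W;U_l^{i_{1:l}}\mid\tilde\mu_l^{i_{1:l}})$ under the expectation $\mathbb E_{\tilde\mu_l^{i_{1:l}}}$ be this function evaluated at the random $\tilde\mu_l^{i_{1:l}}$. **Claim.** $$\mathrm{gen}(P_{W|\mu})\;\le\;\sum_{l=1}^{L}\frac1{N_l}\sum_{i_{1:l}}\mathbb E_{\tilde\mu_l^{i_{1:l}}}\sqrt{2\,I\bigl(W;U_l^{i_{1:l}}\mid\tilde\mu_l^{i_{1:l}}\bigr)} .$$ -/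

import Mathlib

open MeasureTheory ProbabilityTheory
open scoped ENNReal

noncomputable section

namespace HierFL

universe u v

/-! ### Spaces of nodes: iterated spaces of probability measures -/

/-- `bundledNode Z h` carries the values of a node which lies `h` levels above the leaves:
`Z` for `h = 0`, and probability measures (with the Giry `σ`-algebra) on the values of the
nodes one level below for `h + 1`. -/
def bundledNode (Z : Type u) [MeasurableSpace Z] : ℕ → MeasCat.{u}
  | 0 => MeasCat.of Z
  | h + 1 => MeasCat.of (ProbabilityMeasure (bundledNode Z h))

/-- `NodeSpace Z 0 = Z` and `NodeSpace Z (h + 1) = ProbabilityMeasure (NodeSpace Z h)`. -/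
def NodeSpace (Z : Type u) [MeasurableSpace Z] (h : ℕ) : Type u := bundledNode Z h

instance (Z : Type u) [MeasurableSpace Z] (h : ℕ) : MeasurableSpace (NodeSpace Z h) :=
  inferInstanceAs (MeasurableSpace (bundledNode Z h))

variable {Z : Type u} [MeasurableSpace Z]

/-- The probability measure which a non-leaf node is. -/
def NodeSpace.toProb {h : ℕ} (x : NodeSpace Z (h + 1)) : ProbabilityMeasure (NodeSpace Z h) := x

theorem NodeSpace.measurable_toProb {h : ℕ} :
    Measurable (NodeSpace.toProb : NodeSpace Z (h + 1) → ProbabilityMeasure (NodeSpace Z h)) :=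
  measurable_id

/-- Sampling a child from its parent node: the kernel `x ↦ x`. -/
def child (Z : Type u) [MeasurableSpace Z] (h : ℕ) :
    Kernel (NodeSpace Z (h + 1)) (NodeSpace Z h) where
  toFun x := (x.toProb : Measure (NodeSpace Z h))
  measurable' := measurable_subtype_coe.comp NodeSpace.measurable_toProb

instance (h : ℕ) : IsMarkovKernel (child Z h) :=
  ⟨fun x => inferInstanceAs (IsProbabilityMeasure (x.toProb : Measure (NodeSpace Z h)))⟩

/-- The law of one test leaf below a node of height `h`, sampled along the whole chain. -/
def leafKernel (Z : Type u) [MeasurableSpace Z] : (h : ℕ) → Kernel (NodeSpace Z h) Z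
  | 0 => (Kernel.id : Kernel Z Z)
  | h + 1 => leafKernel Z h ∘ₖ child Z h

/-! ### Independent copies -/

/-- `m` independent draws from `κ a`. -/
def iid {α β : Type*} [MeasurableSpace α] [MeasurableSpace β] (m : ℕ) (κ : Kernel α β)
    [IsMarkovKernel κ] : Kernel α (Fin m → β) where
  toFun a := Measure.pi fun _ => κ a
  measurable' := by
    refine Measurable.measure_of_isPiSystem_of_isProbabilityMeasure generateFrom_pi.symm
      (isPiSystem_pi (α := fun _ : Fin m => β)) ?_
    rintro _ ⟨s, hs, rfl⟩
    simp only [Measure.pi_pi]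
    exact Finset.measurable_fun_prod _ fun i _ => κ.measurable_coe (hs i (Set.mem_univ i))

instance {α β : Type*} [MeasurableSpace α] [MeasurableSpace β] (m : ℕ) (κ : Kernel α β)
    [IsMarkovKernel κ] : IsMarkovKernel (iid m κ) :=
  ⟨fun a => inferInstanceAs (IsProbabilityMeasure (Measure.pi fun _ => κ a))⟩

/-! ### The dataset

The branching factors are a sequence `n`, where `n k` is the number of children of every node of
depth `k` (so `n 0` is the number of nodes of depth `1`). Below the root, the dataset consists of
`n 0` subtrees, whose branching factors are `n 1, n 2, …`. -/

/-- The realizations of all nodes strictly below the root, in a tree of depth `L`. -/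
def Tree (Z : Type u) [MeasurableSpace Z] : (L : ℕ) → (n : ℕ → ℕ) → Type u
  | 0, _ => PUnit
  | L + 1, n => Fin (n 0) → NodeSpace Z L × Tree Z L (fun k => n (k + 1))

instance instMeasurableSpaceTree : (L : ℕ) → (n : ℕ → ℕ) → MeasurableSpace (Tree Z L n)
  | 0, _ => inferInstanceAs (MeasurableSpace PUnit)
  | L + 1, n =>
    have := instMeasurableSpaceTree L (fun k => n (k + 1))
    inferInstanceAs (MeasurableSpace (Fin (n 0) → NodeSpace Z L × Tree Z L (fun k => n (k + 1))))

/-- There is no node below the root of a tree of depth `0`. -/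
def Tree.nil (n : ℕ → ℕ) : Tree Z 0 n := PUnit.unit

/-- Law of the dataset given the root, bundled with the fact that it is a Markov kernel: the
children of a node are i.i.d. from that node, and the subtrees are sampled recursively. -/
def treeKernelAux (Z : Type u) [MeasurableSpace Z] : (L : ℕ) → (n : ℕ → ℕ) →
    {κ : Kernel (NodeSpace Z L) (Tree Z L n) // IsMarkovKernel κ}
  | 0, n => ⟨Kernel.const _ (Measure.dirac (Tree.nil n)), inferInstance⟩
  | L + 1, n =>
    have := (treeKernelAux Z L (fun k => n (k + 1))).2
    ⟨iid (n 0) (child Z L ⊗ₖ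
      Kernel.prodMkLeft (NodeSpace Z (L + 1)) (treeKernelAux Z L (fun k => n (k + 1))).1),
      inferInstanceAs (IsMarkovKernel (iid (n 0) (child Z L ⊗ₖ
        Kernel.prodMkLeft (NodeSpace Z (L + 1)) (treeKernelAux Z L (fun k => n (k + 1))).1)))⟩

/-- The law of the dataset whose root is the meta-distribution `D`. -/
def treeLaw (L : ℕ) (n : ℕ → ℕ) (D : NodeSpace Z L) : Measure (Tree Z L n) :=
  (treeKernelAux Z L n).1 D

instance (L : ℕ) (n : ℕ → ℕ) (D : NodeSpace Z L) : IsProbabilityMeasure (treeLaw L n D) :=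
  (treeKernelAux Z L n).2.isProbabilityMeasure D

/-- Positions `i_{1:l}` of the nodes of depth `l`. -/
abbrev Path (n : ℕ → ℕ) (l : ℕ) : Type := (k : Fin l) → Fin (n k)

/-- The number `N_l = n_1 ⋯ n_l` of nodes of depth `l`. -/
def numNodes (n : ℕ → ℕ) (l : ℕ) : ℕ := ∏ k ∈ Finset.range l, n k

/-- The data point at the leaf with position `i` (for `L = 0` the root `x` is the only leaf). -/
def leaf : (L : ℕ) → (n : ℕ → ℕ) → NodeSpace Z L → Tree Z L n → Path n L → Z
  | 0, _, x, _, _ => x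
  | L + 1, n, _, t, i =>
    leaf L (fun k => n (k + 1)) (t (i ⟨0, L.succ_pos⟩)).1 (t (i ⟨0, L.succ_pos⟩)).2
      (fun k => i k.succ)

/-! ### Generalization error -/

variable {W : Type v} [MeasurableSpace W]

/-- Empirical risk. -/
def empRisk (ℓ : W → Z → ℝ) {L : ℕ} {n : ℕ → ℕ} (D : NodeSpace Z L) (w : W) (t : Tree Z L n) : ℝ :=
  (numNodes n L : ℝ)⁻¹ * ∑ i : Path n L, ℓ w (leaf L n D t i)

/-- Population risk. -/
def popRisk (ℓ : W → Z → ℝ) {L : ℕ} (D : NodeSpace Z L) (w : W) : ℝ :=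
  ∫ z, ℓ w z ∂(leafKernel Z L D)

/-- Expected generalization error of the algorithm `A`, which maps the dataset to a
distribution over hypotheses. -/
def genError (ℓ : W → Z → ℝ) {L : ℕ} {n : ℕ → ℕ} (D : NodeSpace Z L)
    (A : Kernel (Tree Z L n) W) : ℝ :=
  ∫ x : Tree Z L n × W, (popRisk ℓ D x.2 - empRisk ℓ D x.2 x.1) ∂(treeLaw L n D ⊗ₘ A)

/-! ### Supersample

Selection variables take the values `0, 1` in `Fin 2` instead of `1, 2`. -/

/-- The selected component of a pair. -/
def pick {α : Type*} (q : (α × α) × Fin 2) : α := if q.2 = 0 then q.1.1 else q.1.2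

theorem measurable_pick {α : Type*} [MeasurableSpace α] :
    Measurable (pick : (α × α) × Fin 2 → α) :=
  Measurable.ite (measurable_snd (measurableSet_singleton 0))
    (measurable_fst.comp measurable_fst) (measurable_snd.comp measurable_fst)

/-- The uniform distribution on the two values of a selection variable. -/
def coin : Measure (Fin 2) := (PMF.uniformOfFintype (Fin 2)).toMeasure

instance : IsProbabilityMeasure coin :=
  inferInstanceAs (IsProbabilityMeasure (PMF.uniformOfFintype (Fin 2)).toMeasure)

/-- For every node strictly below the root: a pair of candidates and a selection variable. -/
def SuperTree (Z : Type u) [MeasurableSpace Z] : (L : ℕ) → (n : ℕ → ℕ) → Type u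
  | 0, _ => PUnit
  | L + 1, n => Fin (n 0) →
      ((NodeSpace Z L × NodeSpace Z L) × Fin 2) × SuperTree Z L (fun k => n (k + 1))

instance instMeasurableSpaceSuperTree :
    (L : ℕ) → (n : ℕ → ℕ) → MeasurableSpace (SuperTree Z L n)
  | 0, _ => inferInstanceAs (MeasurableSpace PUnit)
  | L + 1, n =>
    have := instMeasurableSpaceSuperTree L (fun k => n (k + 1))
    inferInstanceAs (MeasurableSpace (Fin (n 0) →
      ((NodeSpace Z L × NodeSpace Z L) × Fin 2) × SuperTree Z L (fun k => n (k + 1))))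

/-- There is no node below the root of a tree of depth `0`. -/
def SuperTree.nil (n : ℕ → ℕ) : SuperTree Z 0 n := PUnit.unit

/-- Given its (selected) parent, a pair of candidates is drawn i.i.d. from the parent, and an
independent uniform selection variable is drawn. -/
def pairKernel (Z : Type u) [MeasurableSpace Z] (h : ℕ) :
    Kernel (NodeSpace Z (h + 1)) ((NodeSpace Z h × NodeSpace Z h) × Fin 2) :=
  (child Z h ×ₖ child Z h) ×ₖ Kernel.const _ coin

instance (h : ℕ) : IsMarkovKernel (pairKernel Z h) :=
  inferInstanceAs (IsMarkovKernel ((child Z h ×ₖ child Z h) ×ₖ Kernel.const _ coin))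

/-- Law of the supersample given the root, bundled with the fact that it is a Markov kernel: the
supersample below a node is generated from the selected candidate of that node. -/
def superKernelAux (Z : Type u) [MeasurableSpace Z] : (L : ℕ) → (n : ℕ → ℕ) →
    {κ : Kernel (NodeSpace Z L) (SuperTree Z L n) // IsMarkovKernel κ}
  | 0, n => ⟨Kernel.const _ (Measure.dirac (SuperTree.nil n)), inferInstance⟩
  | L + 1, n =>
    have := (superKernelAux Z L (fun k => n (k + 1))).2
    ⟨iid (n 0) (pairKernel Z L ⊗ₖ Kernel.prodMkLeft (NodeSpace Z (L + 1))
      ((superKernelAux Z L (fun k => n (k + 1))).1.comap pick measurable_pick)),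
      inferInstanceAs (IsMarkovKernel (iid (n 0) (pairKernel Z L ⊗ₖ
        Kernel.prodMkLeft (NodeSpace Z (L + 1))
          ((superKernelAux Z L (fun k => n (k + 1))).1.comap pick measurable_pick))))⟩

/-- The law of the supersample whose root is the meta-distribution `D`. -/
def superLaw (L : ℕ) (n : ℕ → ℕ) (D : NodeSpace Z L) : Measure (SuperTree Z L n) :=
  (superKernelAux Z L n).1 D

instance (L : ℕ) (n : ℕ → ℕ) (D : NodeSpace Z L) : IsProbabilityMeasure (superLaw L n D) :=
  (superKernelAux Z L n).2.isProbabilityMeasure D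

/-- The dataset of the selected nodes. -/
def select : (L : ℕ) → (n : ℕ → ℕ) → SuperTree Z L n → Tree Z L n
  | 0, n, _ => Tree.nil n
  | L + 1, n, s => fun j => (pick (s j).1, select L (fun k => n (k + 1)) (s j).2)

theorem measurable_select : (L : ℕ) → (n : ℕ → ℕ) →
    Measurable (select L n : SuperTree Z L n → Tree Z L n)
  | 0, n => measurable_const (a := Tree.nil n)
  | L + 1, n => by
    refine measurable_pi_lambda _ fun j => ?_
    have hj : Measurable fun s : SuperTree Z (L + 1) n => s j := measurable_pi_apply j
    exact (measurable_pick.comp (measurable_fst.comp hj)).prodMk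
      ((measurable_select L (fun k => n (k + 1))).comp (measurable_snd.comp hj))

/-- The joint law of the supersample (with the selection variables) and of the hypothesis which
the algorithm outputs on the selected dataset. -/
def jointLaw {L : ℕ} {n : ℕ → ℕ} (D : NodeSpace Z L) (A : Kernel (Tree Z L n) W) :
    Measure (SuperTree Z L n × W) :=
  superLaw L n D ⊗ₘ A.comap (select L n) (measurable_select L n)

instance {L : ℕ} {n : ℕ → ℕ} (D : NodeSpace Z L) (A : Kernel (Tree Z L n) W) [IsMarkovKernel A] :
    IsProbabilityMeasure (jointLaw D A) :=
  inferInstanceAs (IsProbabilityMeasure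
    (superLaw L n D ⊗ₘ A.comap (select L n) (measurable_select L n)))

/-- The height above the leaves of the nodes of depth `l + 1` in a tree of depth `L`. -/
def height : (L : ℕ) → Fin L → ℕ
  | L + 1, ⟨0, _⟩ => L
  | L + 1, ⟨l + 1, hl⟩ => height L ⟨l, Nat.lt_of_succ_lt_succ hl⟩

theorem height_eq : (L : ℕ) → (l : Fin L) → height L l = L - (l + 1)
  | _ + 1, ⟨0, _⟩ => by simp [height]
  | _ + 1, ⟨l + 1, hl⟩ => by
    rw [height, height_eq _ ⟨l, Nat.lt_of_succ_lt_succ hl⟩]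
    simp

/-- The pair of candidates and the selection variable at the node of depth `l + 1` with
position `i`. -/
def entry : (L : ℕ) → (n : ℕ → ℕ) → (l : Fin L) → Path n (l + 1) → SuperTree Z L n →
    (NodeSpace Z (height L l) × NodeSpace Z (height L l)) × Fin 2
  | L + 1, _, ⟨0, _⟩, i, s => (s (i ⟨0, Nat.succ_pos _⟩)).1
  | L + 1, n, ⟨l + 1, hl⟩, i, s =>
    entry L (fun k => n (k + 1)) ⟨l, Nat.lt_of_succ_lt_succ hl⟩ (fun k => i k.succ)
      (s (i ⟨0, Nat.succ_pos _⟩)).2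

theorem measurable_entry : (L : ℕ) → (n : ℕ → ℕ) → (l : Fin L) → (i : Path n (l + 1)) →
    Measurable (entry (Z := Z) L n l i)
  | _ + 1, _, ⟨0, _⟩, i =>
    measurable_fst.comp (measurable_pi_apply (i ⟨0, Nat.succ_pos _⟩))
  | L + 1, n, ⟨l + 1, hl⟩, i =>
    (measurable_entry L (fun k => n (k + 1)) ⟨l, Nat.lt_of_succ_lt_succ hl⟩
      (fun k => i k.succ)).comp
      (measurable_snd.comp (measurable_pi_apply (i ⟨0, Nat.succ_pos _⟩)))

/-! ### Mutual information given a realization -/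

/-- The mutual information (in nats) of `X` and `Y` under the conditional law given `V = c`,
`D_KL (P_{X,Y | V = c} ‖ P_{X | V = c} ⊗ P_{Y | V = c})`. Its mean over the law of `V` is the
conditional mutual information of `X` and `Y` given `V`. -/
def mutualInfoAt {Ω α β γ : Type*} [MeasurableSpace Ω] [MeasurableSpace α] [StandardBorelSpace α]
    [Nonempty α] [MeasurableSpace β] [StandardBorelSpace β] [Nonempty β] [MeasurableSpace γ]
    (X : Ω → α) (Y : Ω → β) (V : Ω → γ) (P : Measure Ω) [IsFiniteMeasure P] (c : γ) : ℝ≥0∞ :=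
  InformationTheory.klDiv (condDistrib (fun ω => (X ω, Y ω)) V P c)
    ((condDistrib X V P c).prod (condDistrib Y V P c))

/-- `E_{μ̃} √(2 I(W; U | μ̃))` for the pair of candidates `μ̃` and the selection variable `U` at the
node of depth `l + 1` with position `i`. -/
def nodeTerm {L : ℕ} {n : ℕ → ℕ} [StandardBorelSpace W] [Nonempty W] (D : NodeSpace Z L)
    (A : Kernel (Tree Z L n) W) [IsMarkovKernel A] (l : Fin L) (i : Path n (l + 1)) : ℝ≥0∞ :=
  ∫⁻ c, (2 * mutualInfoAt (fun ω => ω.2) (fun ω => (entry L n l i ω.1).2)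
      (fun ω => (entry L n l i ω.1).1) (jointLaw D A) c) ^ (1 / 2 : ℝ)
    ∂((jointLaw D A).map fun ω => (entry L n l i ω.1).1)

end HierFL

end

namespace HierFL

universe u v

/-! ### Bounded centred functions and relative entropy -/

/-! Replacing the root by the nodes further and further down the tree splits the population risk
minus the empirical risk, pointwise, into averages over the nodes of each depth
(`popRisk_sub_empRisk`). The contribution of a node is `riskGap`: the mean risk below a fresh child
of its parent, minus the risk below the node itself.

The unselected candidate plays the part of the fresh child. Given the whole selected dataset, it is
distributed as a draw from the selected parent (`map_select_unpick_superLaw`), and the output `W`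
depends on the supersample only through that dataset. So the mean of `riskGap` is the mean risk
below the unselected candidate minus that below the selected one (`integral_riskGap`).

Condition now on the pair of candidates. This difference is a function of `W` and the selection
variable with values in `[-1, 1]`, and flipping the selection changes its sign. The selection
variable is uniform given the pair (`map_entry_superLaw`), so the function is centred under the
product of the conditional marginals. The Donsker–Varadhan inequality with Hoeffding's lemma then
bounds its mean by the square root of twice the mutual information
(`ofReal_integral_le_sqrt_klDiv`). -/

/-- The Donsker–Varadhan inequality. -/
theorem integral_le_toReal_klDiv_add_log {α : Type*} [MeasurableSpace α] {μ ν : Measure α}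
    [IsProbabilityMeasure μ] [IsProbabilityMeasure ν] {f : α → ℝ} (hfμ : Integrable f μ)
    (hfν : Integrable (fun x => Real.exp (f x)) ν) (hac : μ ≪ ν) (hint : Integrable (llr μ ν) μ) :
    ∫ x, f x ∂μ ≤ (InformationTheory.klDiv μ ν).toReal + Real.log (∫ x, Real.exp (f x) ∂ν) := by
  have := isProbabilityMeasure_tilted hfν
  -- The inequality is the nonnegativity of the relative entropy of `μ` with respect to `ν` tilted
  -- by `f`.
  have h := InformationTheory.integral_llr_add_sub_measure_univ_nonneg
    (hac.trans (absolutelyContinuous_tilted hfν)) (integrable_llr_tilted_right hac hfμ hint hfν)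
  rw [integral_llr_tilted_right hac hfμ hfν hint] at h
  rw [InformationTheory.toReal_klDiv_of_measure_eq hac (by simp)]
  simp at h
  linarith

/-- By Hoeffding's lemma a centred function with values in `[-1, 1]` is sub-Gaussian with variance
proxy `1`, so its log-moment generating function at `E` is at most `E ^ 2 / 2`. -/
theorem ofReal_integral_le_sqrt_klDiv {α : Type*} [MeasurableSpace α] {μ ν : Measure α}
    [IsProbabilityMeasure μ] [IsProbabilityMeasure ν] {f : α → ℝ} (hf : Measurable f)
    (hb : ∀ x, f x ∈ Set.Icc (-1 : ℝ) 1) (h0 : ∫ x, f x ∂ν = 0) :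
    ENNReal.ofReal (∫ x, f x ∂μ) ≤ (2 * InformationTheory.klDiv μ ν) ^ (1 / 2 : ℝ) := by
  by_cases htop : InformationTheory.klDiv μ ν = ∞
  · simp [htop]
  obtain ⟨hac, hint⟩ := InformationTheory.klDiv_ne_top_iff.1 htop
  set E := ∫ x, f x ∂μ with hE
  rcases le_or_gt E 0 with hneg | hpos
  · simp [ENNReal.ofReal_of_nonpos hneg]
  have hsub := hasSubgaussianMGF_of_mem_Icc_of_integral_eq_zero (μ := ν) hf.aemeasurable
    (ae_of_all _ hb) h0
  have hfμ : Integrable f μ := Integrable.of_mem_Icc (-1) 1 hf.aemeasurable (ae_of_all _ hb)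
  -- Applied to `λ f`, Donsker–Varadhan gives `λ E ≤ KL + λ ^ 2 / 2`; the optimal parameter is `λ =
  -- E`.
  have h1 := integral_le_toReal_klDiv_add_log (hfμ.const_mul E) (hsub.integrable_exp_mul E) hac hint
  rw [integral_const_mul, ← hE] at h1
  have h2 : Real.log (∫ x, Real.exp (E * f x) ∂ν) ≤ E ^ 2 / 2 := by
    refine (Real.log_le_log (integral_exp_pos (hsub.integrable_exp_mul E)) (hsub.mgf_le E)).trans ?_
    rw [Real.log_exp]
    norm_num
  have h3 : E ^ 2 ≤ 2 * (InformationTheory.klDiv μ ν).toReal := by nlinarith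
  rw [one_div, ENNReal.le_rpow_inv_iff two_pos, ENNReal.ofReal_rpow_of_nonneg hpos.le two_pos.le,
    Real.rpow_two]
  refine (ENNReal.ofReal_le_ofReal h3).trans_eq ?_
  rw [ENNReal.ofReal_mul two_pos.le, ENNReal.ofReal_toReal htop, ENNReal.ofReal_ofNat]

/-! ### Products of kernels -/

/-- A map of an i.i.d. family, together with one more function of a single coordinate. -/
theorem map_pi_prodMk_eval {ι α T B : Type*} [Fintype ι] [MeasurableSpace α] [MeasurableSpace T]
    [MeasurableSpace B] {ν : Measure α} [IsProbabilityMeasure ν] {φ : α → T} {ψ : α → B}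
    (hφ : Measurable φ) (hψ : Measurable ψ) {τ : Measure T} [IsProbabilityMeasure τ]
    {κ : Kernel T B} [IsMarkovKernel κ]
    (h : ν.map (fun a => (φ a, ψ a)) = τ ⊗ₘ κ) (i : ι) :
    (Measure.pi fun _ : ι => ν).map (fun s => ((fun j => φ (s j)), ψ (s i))) =
      (Measure.pi fun _ : ι => τ) ⊗ₘ κ.comap (fun t : ι → T => t i) (measurable_pi_apply i) := by
  classical
  have hφψ : Measurable fun s : ι → α => ((fun j => φ (s j)), ψ (s i)) := by fun_prop
  have hrect : ∀ (S : Set T) (C : Set B), MeasurableSet S → MeasurableSet C →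
      ν (φ ⁻¹' S ∩ ψ ⁻¹' C) = ∫⁻ t in S, κ t C ∂τ := by
    intro S C hS hC
    rw [← Measure.compProd_apply_prod hS hC, ← h, Measure.map_apply (by fun_prop) (hS.prod hC)]
    rfl
  have : IsProbabilityMeasure
      ((Measure.pi fun _ : ι => ν).map (fun s => ((fun j => φ (s j)), ψ (s i)))) :=
    Measure.isProbabilityMeasure_map hφψ.aemeasurable
  refine ext_of_generate_finite _ (generateFrom_eq_prod generateFrom_pi
    (MeasurableSpace.generateFrom_measurableSet (α := B))
    (IsCountablySpanning.pi fun _ => isCountablySpanning_measurableSet)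
    isCountablySpanning_measurableSet).symm
    (IsPiSystem.prod isPiSystem_pi MeasurableSpace.isPiSystem_measurableSet) ?_ (by simp)
  rintro _ ⟨_, ⟨S, hS, rfl⟩, C, hC, rfl⟩
  have hS' : ∀ j, MeasurableSet (S j) := fun j => hS j (Set.mem_univ j)
  replace hC : MeasurableSet C := hC
  rw [Measure.map_apply hφψ ((MeasurableSet.univ_pi hS').prod hC),
    Measure.compProd_apply_prod (MeasurableSet.univ_pi hS') hC]
  -- The condition on `ψ` concerns coordinate `i` only. Written as a vacuous condition at the other
  -- coordinates, it leaves a box, whose measure factors.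
  have hpre : (fun s : ι → α => ((fun j => φ (s j)), ψ (s i))) ⁻¹' (Set.univ.pi S ×ˢ C) =
      Set.univ.pi fun j => φ ⁻¹' S j ∩ ψ ⁻¹' (if j = i then C else Set.univ) := by
    ext s
    simp only [Set.mem_preimage, Set.mem_prod, Set.mem_pi, Set.mem_univ, true_implies,
      Set.mem_inter_iff]
    constructor
    · rintro ⟨h1, h2⟩ j
      refine ⟨h1 j, ?_⟩
      split_ifs with hj
      · exact hj ▸ h2
      · trivial
    · intro h1
      exact ⟨fun j => (h1 j).1, by simpa using (h1 i).2⟩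
  -- The same factorization on the other side; the factors with `j ≠ i` are right because `κ` is
  -- Markov.
  have hfac : ∀ t : ι → T, (Set.univ.pi S).indicator (fun t => κ (t i) C) t =
      ∏ j, (S j).indicator (fun x => κ x (if j = i then C else Set.univ)) (t j) := by
    intro t
    by_cases ht : t ∈ Set.univ.pi S
    · rw [Set.indicator_of_mem ht]
      rw [Finset.prod_eq_single i]
      · simp [Set.indicator_of_mem (ht i trivial)]
      · intro j _ hj
        simp [Set.indicator_of_mem (ht j trivial), hj]
      · simp
    · rw [Set.indicator_of_notMem ht]
      simp only [Set.mem_pi, Set.mem_univ, true_implies, not_forall] at ht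
      obtain ⟨j, hj⟩ := ht
      exact (Finset.prod_eq_zero (Finset.mem_univ j) (Set.indicator_of_notMem hj _)).symm
  have hmeas : ∀ j, MeasurableSet (if j = i then C else Set.univ) := by
    intro j
    split_ifs
    exacts [hC, MeasurableSet.univ]
  rw [hpre, Measure.pi_pi, ← lintegral_indicator (MeasurableSet.univ_pi hS')]
  simp only [Kernel.comap_apply]
  simp_rw [hfac]
  have hg : ∀ j, Measurable ((S j).indicator fun x => κ x (if j = i then C else Set.univ)) :=
    fun j => (κ.measurable_coe (hmeas j)).indicator (hS' j)
  rw [lintegral_prod_eq_prod_lintegral_of_indepFun Finset.univ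
    (fun j (t : ι → T) => (S j).indicator (fun x => κ x (if j = i then C else Set.univ)) (t j))
    (iIndepFun_pi fun j => (hg j).aemeasurable) fun j => (hg j).comp (measurable_pi_apply j)]
  refine Finset.prod_congr rfl fun j _ => ?_
  rw [hrect _ _ (hS' j) (hmeas j), ← lintegral_indicator (hS' j)]
  exact ((measurePreserving_eval (fun _ : ι => τ) j).lintegral_comp (hg j)).symm

/-! ### The selected and the unselected candidates -/

/-- The component of a pair which is not selected. -/
def unpick {α : Type*} (q : (α × α) × Fin 2) : α := if q.2 = 0 then q.1.2 else q.1.1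

theorem measurable_unpick {α : Type*} [MeasurableSpace α] :
    Measurable (unpick : (α × α) × Fin 2 → α) :=
  Measurable.ite (measurable_snd (measurableSet_singleton 0))
    (measurable_snd.comp measurable_fst) (measurable_fst.comp measurable_fst)

theorem coin_singleton (u : Fin 2) : coin {u} = 2⁻¹ := by
  simp [coin]

theorem lintegral_coin (f : Fin 2 → ℝ≥0∞) : ∫⁻ u, f u ∂coin = 2⁻¹ * (f 0 + f 1) := by
  rw [lintegral_fintype]
  simp [coin_singleton, mul_comm, mul_add]

/-- Either value of the selection variable leaves the pair as it is or swaps it, and `μ.prod μ` is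
invariant under the swap. Hence the selected and the unselected candidate are again independent
draws. -/
theorem map_pick_unpick {α : Type*} [MeasurableSpace α] (μ : Measure α) [IsProbabilityMeasure μ] :
    ((μ.prod μ).prod coin).map (fun q => (pick q, unpick q)) = μ.prod μ := by
  ext S hS
  have hm : Measurable fun q : (α × α) × Fin 2 => (pick q, unpick q) :=
    measurable_pick.prodMk measurable_unpick
  rw [Measure.map_apply hm hS, Measure.prod_apply_symm (hm hS), lintegral_coin]
  have h0 : (fun x : α × α => (x, (0 : Fin 2))) ⁻¹' ((fun q => (pick q, unpick q)) ⁻¹' S) = S := by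
    ext x
    simp [pick, unpick]
  have h1 : (fun x : α × α => (x, (1 : Fin 2))) ⁻¹' ((fun q => (pick q, unpick q)) ⁻¹' S) =
      Prod.swap ⁻¹' S := by
    ext x
    simp [pick, unpick, Prod.swap]
  rw [h0, h1, ← Measure.map_apply measurable_swap hS, Measure.prod_swap, ← two_mul, ← mul_assoc,
    ENNReal.inv_mul_cancel (by simp) (by simp), one_mul]

variable {Z : Type u} [MeasurableSpace Z]

theorem pairKernel_apply (h : ℕ) (D : NodeSpace Z (h + 1)) :
    pairKernel Z h D = ((child Z h D).prod (child Z h D)).prod coin := by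
  rw [pairKernel, Kernel.prod_apply, Kernel.prod_apply, Kernel.const_apply]

theorem lintegral_pairKernel (h : ℕ) (D : NodeSpace Z (h + 1))
    {F : NodeSpace Z h × NodeSpace Z h → ℝ≥0∞} (hF : Measurable F) :
    ∫⁻ q, F (pick q, unpick q) ∂(pairKernel Z h D) =
      ∫⁻ x, ∫⁻ y, F (x, y) ∂(child Z h D) ∂(child Z h D) := by
  rw [← lintegral_prod _ hF.aemeasurable, ← map_pick_unpick, ← pairKernel_apply,
    lintegral_map hF (measurable_pick.prodMk measurable_unpick)]

theorem lintegral_pairKernel_pick (h : ℕ) (D : NodeSpace Z (h + 1))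
    {F : NodeSpace Z h → ℝ≥0∞} (hF : Measurable F) :
    ∫⁻ q, F (pick q) ∂(pairKernel Z h D) = ∫⁻ x, F x ∂(child Z h D) := by
  rw [lintegral_pairKernel h D (F := fun p => F p.1) (hF.comp measurable_fst)]
  simp

/-! ### Recursive description of the laws of the dataset and of the supersample -/

instance (L : ℕ) (n : ℕ → ℕ) : IsMarkovKernel (treeKernelAux Z L n).1 := (treeKernelAux Z L n).2

instance (L : ℕ) (n : ℕ → ℕ) : IsMarkovKernel (superKernelAux Z L n).1 := (superKernelAux Z L n).2

/-- The law of a child of the root together with the subtree below it. -/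
noncomputable def treeCell (L : ℕ) (n : ℕ → ℕ) (D : NodeSpace Z (L + 1)) :
    Measure (NodeSpace Z L × Tree Z L n) :=
  child Z L D ⊗ₘ (treeKernelAux Z L n).1

/-- The law of a pair of candidates below the root, with its selection variable, together with the
supersample below the selected candidate. -/
noncomputable def superCell (L : ℕ) (n : ℕ → ℕ) (D : NodeSpace Z (L + 1)) :
    Measure (((NodeSpace Z L × NodeSpace Z L) × Fin 2) × SuperTree Z L n) :=
  pairKernel Z L D ⊗ₘ (superKernelAux Z L n).1.comap pick measurable_pick

instance (L : ℕ) (n : ℕ → ℕ) (D : NodeSpace Z (L + 1)) : IsProbabilityMeasure (treeCell L n D) :=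
  inferInstanceAs (IsProbabilityMeasure (child Z L D ⊗ₘ (treeKernelAux Z L n).1))

instance (L : ℕ) (n : ℕ → ℕ) (D : NodeSpace Z (L + 1)) : IsProbabilityMeasure (superCell L n D) :=
  inferInstanceAs (IsProbabilityMeasure
    (pairKernel Z L D ⊗ₘ (superKernelAux Z L n).1.comap pick measurable_pick))

theorem treeLaw_succ (L : ℕ) (n : ℕ → ℕ) (D : NodeSpace Z (L + 1)) :
    treeLaw (L + 1) n D =
      (Measure.pi fun _ : Fin (n 0) => treeCell L (fun k => n (k + 1)) D) := by
  have : (child Z L ⊗ₖ Kernel.prodMkLeft (NodeSpace Z (L + 1))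
      (treeKernelAux Z L (fun k => n (k + 1))).1) D = treeCell L (fun k => n (k + 1)) D := by
    refine Measure.ext_of_lintegral _ fun f hf => ?_
    rw [Kernel.lintegral_compProd _ _ _ hf, treeCell, Measure.lintegral_compProd hf]
    rfl
  rw [← this]
  rfl

theorem superLaw_succ (L : ℕ) (n : ℕ → ℕ) (D : NodeSpace Z (L + 1)) :
    superLaw (L + 1) n D =
      (Measure.pi fun _ : Fin (n 0) => superCell L (fun k => n (k + 1)) D) := by
  have : (pairKernel Z L ⊗ₖ Kernel.prodMkLeft (NodeSpace Z (L + 1))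
      ((superKernelAux Z L (fun k => n (k + 1))).1.comap pick measurable_pick)) D =
        superCell L (fun k => n (k + 1)) D := by
    refine Measure.ext_of_lintegral _ fun f hf => ?_
    rw [Kernel.lintegral_compProd _ _ _ hf, superCell, Measure.lintegral_compProd hf]
    rfl
  rw [← this]
  rfl

theorem lintegral_treeCell (L : ℕ) (n : ℕ → ℕ) (D : NodeSpace Z (L + 1))
    {F : NodeSpace Z L × Tree Z L n → ℝ≥0∞} (hF : Measurable F) :
    ∫⁻ a, F a ∂(treeCell L n D) = ∫⁻ x, ∫⁻ t, F (x, t) ∂(treeLaw L n x) ∂(child Z L D) := by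
  rw [treeCell, Measure.lintegral_compProd hF]
  rfl

theorem lintegral_superCell (L : ℕ) (n : ℕ → ℕ) (D : NodeSpace Z (L + 1))
    {F : ((NodeSpace Z L × NodeSpace Z L) × Fin 2) × SuperTree Z L n → ℝ≥0∞} (hF : Measurable F) :
    ∫⁻ a, F a ∂(superCell L n D) =
      ∫⁻ q, ∫⁻ s, F (q, s) ∂(superLaw L n (pick q)) ∂(pairKernel Z L D) := by
  rw [superCell, Measure.lintegral_compProd hF]
  rfl

theorem measurable_lintegral_treeLaw {α : Type*} [MeasurableSpace α] (L : ℕ) (n : ℕ → ℕ)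
    {g : α → NodeSpace Z L} (hg : Measurable g) {F : α × Tree Z L n → ℝ≥0∞} (hF : Measurable F) :
    Measurable fun a => ∫⁻ t, F (a, t) ∂(treeLaw L n (g a)) :=
  Measurable.lintegral_kernel_prod_right' (κ := (treeKernelAux Z L n).1.comap g hg) hF

/-! ### The selected dataset is distributed as the dataset -/

/-- A selected candidate is distributed as one draw from its parent, and what lies below it is
generated from it alone. The induction therefore runs over a single cell, and the i.i.d. family of
cells follows coordinatewise. -/
theorem map_select_superLaw : (L : ℕ) → (n : ℕ → ℕ) → (D : NodeSpace Z L) →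
    (superLaw L n D).map (select L n) = treeLaw L n D
  | 0, n, D => by
    exact Measure.map_dirac' (measurable_select 0 n) (SuperTree.nil n)
  | L + 1, n, D => by
    have hm : Measurable fun a : ((NodeSpace Z L × NodeSpace Z L) × Fin 2) ×
        SuperTree Z L (fun k => n (k + 1)) =>
        (pick a.1, select L (fun k => n (k + 1)) a.2) :=
      (measurable_pick.comp measurable_fst).prodMk ((measurable_select _ _).comp measurable_snd)
    have hcell : (superCell L (fun k => n (k + 1)) D).map
        (fun a => (pick a.1, select L (fun k => n (k + 1)) a.2)) =
          treeCell L (fun k => n (k + 1)) D := by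
      refine Measure.ext_of_lintegral _ fun F hF => ?_
      rw [lintegral_map hF hm, lintegral_superCell L _ D
        (F := fun a => F (pick a.1, select L (fun k => n (k + 1)) a.2)) (hF.comp hm),
        lintegral_treeCell _ _ _ hF,
        ← lintegral_pairKernel_pick _ _
          (measurable_lintegral_treeLaw L _ (g := fun x => x) measurable_id hF)]
      refine lintegral_congr fun q => ?_
      rw [← map_select_superLaw L _ (pick q), lintegral_map (by fun_prop) (measurable_select _ _)]
    rw [superLaw_succ, treeLaw_succ, ← hcell]
    exact (Measure.pi_map_pi fun _ => hm.aemeasurable)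

/-! ### The unselected candidate given the selected dataset -/

/-- The law of an independent copy of the node of depth `l + 1` with position `i`, given the root
and the dataset: a draw from the parent of this node. -/
noncomputable def ghostKernel : (L : ℕ) → (n : ℕ → ℕ) → (l : Fin L) → Path n (l + 1) →
    {κ : Kernel (NodeSpace Z L × Tree Z L n) (NodeSpace Z (height L l)) // IsMarkovKernel κ}
  | L + 1, _, ⟨0, _⟩, _ => ⟨(child Z L).comap Prod.fst measurable_fst,
      Kernel.IsMarkovKernel.comap (child Z L) measurable_fst⟩
  | L + 1, n, ⟨l + 1, hl⟩, i =>
    have := (ghostKernel L (fun k => n (k + 1)) ⟨l, Nat.lt_of_succ_lt_succ hl⟩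
      (fun k => i k.succ)).2
    -- The child of the root on the path becomes the root of its own subtree.
    ⟨(ghostKernel L (fun k => n (k + 1)) ⟨l, Nat.lt_of_succ_lt_succ hl⟩ (fun k => i k.succ)).1.comap
      (fun x : NodeSpace Z (L + 1) × Tree Z (L + 1) n => x.2 (i ⟨0, Nat.succ_pos _⟩))
      ((measurable_pi_apply (i ⟨0, Nat.succ_pos _⟩)).comp measurable_snd),
      @Kernel.IsMarkovKernel.comap _ _ _ _ _ _ _ _ this _⟩

instance (L : ℕ) (n : ℕ → ℕ) (l : Fin L) (i : Path n (l + 1)) :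
    IsMarkovKernel (ghostKernel (Z := Z) L n l i).1 := (ghostKernel L n l i).2

/-- No descendants are generated from an unselected candidate, so the selected dataset carries no
information on it beyond its parent. At depth one this is the independence of the two candidates
after selection; deeper nodes are reached by induction inside one cell. `map_pi_prodMk_eval` adds
the other, independent cells. -/
theorem map_select_unpick_superLaw : (L : ℕ) → (n : ℕ → ℕ) → (l : Fin L) → (i : Path n (l + 1)) →
    (D : NodeSpace Z L) →
    (superLaw L n D).map (fun s => (select L n s, unpick (entry L n l i s))) =
      treeLaw L n D ⊗ₘ (ghostKernel L n l i).1.comap (fun t => (D, t)) measurable_prodMk_left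
  | L + 1, n, ⟨0, _⟩, i, D => by
    set n' : ℕ → ℕ := fun k => n (k + 1) with hn'
    have hm : Measurable fun a : ((NodeSpace Z L × NodeSpace Z L) × Fin 2) × SuperTree Z L n' =>
        (pick a.1, select L n' a.2) :=
      (measurable_pick.comp measurable_fst).prodMk ((measurable_select _ _).comp measurable_snd)
    have hm' : Measurable fun a : ((NodeSpace Z L × NodeSpace Z L) × Fin 2) × SuperTree Z L n' =>
        unpick a.1 := measurable_unpick.comp measurable_fst
    -- The subtree grows from the selected candidate only, so the unselected one is independent of
    -- the whole cell.
    have hcell : (superCell L n' D).map (fun a => ((pick a.1, select L n' a.2), unpick a.1)) =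
        treeCell L n' D ⊗ₘ Kernel.const _ (child Z L D) := by
      refine Measure.ext_of_lintegral _ fun F hF => ?_
      have hG : Measurable fun p : NodeSpace Z L × NodeSpace Z L =>
          ∫⁻ t, F ((p.1, t), p.2) ∂(treeLaw L n' p.1) :=
        measurable_lintegral_treeLaw L n' (g := fun p : NodeSpace Z L × NodeSpace Z L => p.1)
          measurable_fst
          (F := fun a => F ((a.1.1, a.2), a.1.2)) (by fun_prop)
      rw [lintegral_map hF (hm.prodMk hm'), lintegral_superCell L n' D
        (F := fun a => F ((pick a.1, select L n' a.2), unpick a.1)) (hF.comp (hm.prodMk hm')),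
        Measure.lintegral_compProd hF]
      simp only [Kernel.const_apply]
      rw [lintegral_treeCell _ _ _ (Measurable.lintegral_prod_right' hF)]
      trans ∫⁻ q, (fun p : NodeSpace Z L × NodeSpace Z L =>
          ∫⁻ t, F ((p.1, t), p.2) ∂(treeLaw L n' p.1)) (pick q, unpick q) ∂(pairKernel Z L D)
      · refine lintegral_congr fun q => ?_
        dsimp only
        rw [← map_select_superLaw L _ (pick q), lintegral_map (by fun_prop) (measurable_select _ _)]
      · rw [lintegral_pairKernel _ _ hG]
        refine lintegral_congr fun x => ?_
        exact lintegral_lintegral_swap (μ := child Z L D) (ν := treeLaw L n' x)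
          (f := fun y t => F ((x, t), y)) (by fun_prop)
    have key := map_pi_prodMk_eval hm hm' hcell (i ⟨0, Nat.succ_pos _⟩)
    rw [superLaw_succ, treeLaw_succ]
    exact key
  | L + 1, n, ⟨l + 1, hl⟩, i, D => by
    set n' : ℕ → ℕ := fun k => n (k + 1) with hn'
    set l' : Fin L := ⟨l, Nat.lt_of_succ_lt_succ hl⟩ with hl'
    set i' : Path n' (l' + 1) := fun k => i k.succ with hi'
    have hm : Measurable fun a : ((NodeSpace Z L × NodeSpace Z L) × Fin 2) × SuperTree Z L n' =>
        (pick a.1, select L n' a.2) :=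
      (measurable_pick.comp measurable_fst).prodMk ((measurable_select _ _).comp measurable_snd)
    have hm' : Measurable fun a : ((NodeSpace Z L × NodeSpace Z L) × Fin 2) × SuperTree Z L n' =>
        unpick (entry L n' l' i' a.2) :=
      measurable_unpick.comp ((measurable_entry L n' l' i').comp measurable_snd)
    have hcell : (superCell L n' D).map
        (fun a => ((pick a.1, select L n' a.2), unpick (entry L n' l' i' a.2))) =
        treeCell L n' D ⊗ₘ (ghostKernel L n' l' i').1 := by
      refine Measure.ext_of_lintegral _ fun F hF => ?_
      have hG : Measurable fun a : NodeSpace Z L × Tree Z L n' =>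
          ∫⁻ y, F (a, y) ∂(ghostKernel L n' l' i').1 a :=
        Measurable.lintegral_kernel_prod_right' hF
      rw [lintegral_map hF (hm.prodMk hm'), lintegral_superCell L n' D
        (F := fun a => F ((pick a.1, select L n' a.2), unpick (entry L n' l' i' a.2)))
        (hF.comp (hm.prodMk hm')), Measure.lintegral_compProd hF, lintegral_treeCell _ _ _ hG,
        ← lintegral_pairKernel_pick _ _
          (measurable_lintegral_treeLaw L _ (g := fun x => x) measurable_id hG)]
      refine lintegral_congr fun q => ?_
      -- The node lies in the supersample whose root is the selected candidate.
      have ih := map_select_unpick_superLaw L n' l' i' (pick q)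
      have hF' : Measurable fun p : Tree Z L n' × NodeSpace Z (height L l') =>
        F ((pick q, p.1), p.2) := by fun_prop
      have := congrArg (fun m => ∫⁻ p, F ((pick q, p.1), p.2) ∂m) ih
      have hu : Measurable fun s => unpick (entry (Z := Z) L n' l' i' s) :=
        measurable_unpick.comp (measurable_entry L n' l' i')
      rw [lintegral_map hF' ((measurable_select _ _).prodMk hu),
        Measure.lintegral_compProd hF'] at this
      exact this
    have key := map_pi_prodMk_eval hm hm' hcell (i ⟨0, Nat.succ_pos _⟩)
    rw [superLaw_succ, treeLaw_succ]
    exact key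

/-! ### The selection variables are independent of the candidates -/

theorem superLaw_eval_apply (L : ℕ) (n : ℕ → ℕ) (D : NodeSpace Z (L + 1)) (j : Fin (n 0))
    {E : Set (((NodeSpace Z L × NodeSpace Z L) × Fin 2) × SuperTree Z L (fun k => n (k + 1)))}
    (hE : MeasurableSet E) :
    superLaw (L + 1) n D {s | s j ∈ E} = ∫⁻ q, superLaw L (fun k => n (k + 1)) (pick q)
      (Prod.mk q ⁻¹' E) ∂(pairKernel Z L D) := by
  rw [superLaw_succ]
  refine ((measurePreserving_eval (fun _ => superCell L (fun k => n (k + 1)) D) j).measure_preimage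
    hE.nullMeasurableSet).trans ?_
  rw [superCell, Measure.compProd_apply hE]
  rfl

theorem superLaw_eval_fst_apply (L : ℕ) (n : ℕ → ℕ) (D : NodeSpace Z (L + 1)) (j : Fin (n 0))
    {S : Set (NodeSpace Z L × NodeSpace Z L)} (hS : MeasurableSet S) (C : Set (Fin 2)) :
    superLaw (L + 1) n D {s | s j ∈ Prod.fst ⁻¹' (S ×ˢ C)} =
      ((child Z L D).prod (child Z L D)) S * coin C := by
  have hSC : MeasurableSet (S ×ˢ C) := hS.prod C.toFinite.measurableSet
  rw [superLaw_eval_apply L n D j (measurable_fst hSC), ← Measure.prod_prod, ← pairKernel_apply,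
    ← lintegral_indicator_one hSC]
  refine lintegral_congr fun q => ?_
  by_cases hq : q ∈ S ×ˢ C
  · have : Prod.mk q ⁻¹' (Prod.fst ⁻¹' (S ×ˢ C)) =
        (Set.univ : Set (SuperTree Z L fun k => n (k + 1))) := by
      ext
      simpa using hq
    rw [this, measure_univ, Set.indicator_of_mem hq, Pi.one_apply]
  · have : Prod.mk q ⁻¹' (Prod.fst ⁻¹' (S ×ˢ C)) =
        (∅ : Set (SuperTree Z L fun k => n (k + 1))) := by
      ext
      simpa using hq
    rw [this, measure_empty, Set.indicator_of_notMem hq]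

/-- Given any parent, the selection variable is uniform and independent of the pair. Since the
factor `coin C` does not depend on the parent, it survives averaging over the ancestors. -/
theorem superLaw_entry_apply : (L : ℕ) → (n : ℕ → ℕ) → (l : Fin L) → (i : Path n (l + 1)) →
    (D : NodeSpace Z L) → {S : Set (NodeSpace Z (height L l) × NodeSpace Z (height L l))} →
    MeasurableSet S → (C : Set (Fin 2)) →
    superLaw L n D (entry L n l i ⁻¹' (S ×ˢ C)) =
      superLaw L n D (entry L n l i ⁻¹' (S ×ˢ Set.univ)) * coin C
  | L + 1, n, ⟨0, _⟩, i, D, S, hS, C => by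
    have h := superLaw_eval_fst_apply L n D (i ⟨0, Nat.succ_pos _⟩) hS
    refine (h C).trans (Eq.trans ?_ (congrArg (· * coin C) (h Set.univ)).symm)
    simp only [measure_univ, mul_one]
  | L + 1, n, ⟨l + 1, hl⟩, i, D, S, hS, C => by
    have hm := measurable_entry (Z := Z) L (fun k => n (k + 1)) ⟨l, Nat.lt_of_succ_lt_succ hl⟩
      (fun k => i k.succ)
    have h : ∀ C : Set (Fin 2), _ := fun C =>
      superLaw_eval_apply L n D (i ⟨0, Nat.succ_pos _⟩)
        (measurable_snd (hm (hS.prod C.toFinite.measurableSet)))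
    refine (h C).trans (Eq.trans ?_ (congrArg (· * coin C) (h Set.univ)).symm)
    refine (lintegral_congr fun q => superLaw_entry_apply L (fun k => n (k + 1))
      ⟨l, Nat.lt_of_succ_lt_succ hl⟩ (fun k => i k.succ) (pick q) hS C).trans ?_
    refine lintegral_mul_const _ ?_
    exact ((superKernelAux Z L (fun k => n (k + 1))).1.comap pick measurable_pick).measurable_coe
      (hm (hS.prod MeasurableSet.univ))

theorem map_entry_superLaw (L : ℕ) (n : ℕ → ℕ) (l : Fin L) (i : Path n (l + 1))
    (D : NodeSpace Z L) :
    (superLaw L n D).map (entry L n l i) =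
      ((superLaw L n D).map fun s => (entry L n l i s).1).prod coin := by
  have hm := measurable_entry (Z := Z) L n l i
  have := Measure.isProbabilityMeasure_map (μ := superLaw L n D) hm.fst.aemeasurable
  refine (Measure.prod_eq fun S C hS hC => ?_).symm
  rw [Measure.map_apply hm (hS.prod hC), superLaw_entry_apply L n l i D hS,
    Measure.map_apply hm.fst hS]
  congr 2
  ext s
  simp

variable {W : Type v}

/-! ### The risk of a hypothesis below a node -/

theorem integrable_of_mem_Icc_zero_one {α : Type*} [MeasurableSpace α] {μ : Measure α}
    [IsProbabilityMeasure μ] {f : α → ℝ} (hf : Measurable f) (hf01 : ∀ a, f a ∈ Set.Icc (0 : ℝ) 1) :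
    Integrable f μ :=
  Integrable.of_mem_Icc 0 1 hf.aemeasurable (ae_of_all _ hf01)

theorem integral_mem_Icc_zero_one {α : Type*} [MeasurableSpace α] {μ : Measure α}
    [IsProbabilityMeasure μ] {f : α → ℝ} (hf : Measurable f) (hf01 : ∀ a, f a ∈ Set.Icc (0 : ℝ) 1) :
    ∫ a, f a ∂μ ∈ Set.Icc (0 : ℝ) 1 := by
  refine ⟨integral_nonneg fun a => (hf01 a).1, ?_⟩
  refine (integral_mono (integrable_of_mem_Icc_zero_one hf hf01) (integrable_const 1)
    fun a => (hf01 a).2).trans_eq ?_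
  simp

instance instIsMarkovKernelLeafKernel : (h : ℕ) → IsMarkovKernel (leafKernel Z h)
  | 0 => inferInstanceAs (IsMarkovKernel (Kernel.id : Kernel Z Z))
  | h + 1 =>
    have : IsMarkovKernel (leafKernel Z h) := instIsMarkovKernelLeafKernel h
    inferInstanceAs (IsMarkovKernel (leafKernel Z h ∘ₖ child Z h))

theorem measurable_popRisk [MeasurableSpace W] {ℓ : W → Z → ℝ}
    (hℓ : Measurable (Function.uncurry ℓ))
    (h : ℕ) :
    Measurable fun p : NodeSpace Z h × W => popRisk ℓ p.1 p.2 := by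
  have : StronglyMeasurable fun q : (NodeSpace Z h × W) × Z => ℓ q.1.2 q.2 :=
    (hℓ.comp (measurable_fst.snd.prodMk measurable_snd)).stronglyMeasurable
  exact (this.integral_kernel_prod_right' (κ := (leafKernel Z h).comap Prod.fst measurable_fst)
    ).measurable

theorem popRisk_mem_Icc [MeasurableSpace W] {ℓ : W → Z → ℝ} (hℓ : Measurable (Function.uncurry ℓ))
    (hℓ01 : ∀ w z, ℓ w z ∈ Set.Icc (0 : ℝ) 1) {h : ℕ} (D : NodeSpace Z h) (w : W) :
    popRisk ℓ D w ∈ Set.Icc (0 : ℝ) 1 :=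
  integral_mem_Icc_zero_one (hℓ.comp measurable_prodMk_left) (hℓ01 w)

theorem popRisk_zero [MeasurableSpace W] {ℓ : W → Z → ℝ} (hℓ : Measurable (Function.uncurry ℓ))
    (z : NodeSpace Z 0) (w : W) : popRisk ℓ z w = ℓ w z :=
  integral_dirac' (ℓ w) z (hℓ.comp measurable_prodMk_left).stronglyMeasurable

/-- The tower property along the chain of a test leaf; it identifies the minuend of `riskGap` with
the risk below the parent. -/
theorem popRisk_succ [MeasurableSpace W] {ℓ : W → Z → ℝ} (hℓ : Measurable (Function.uncurry ℓ))
    (hℓ01 : ∀ w z, ℓ w z ∈ Set.Icc (0 : ℝ) 1) {h : ℕ} (D : NodeSpace Z (h + 1)) (w : W) :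
    popRisk ℓ D w = ∫ x, popRisk ℓ x w ∂(child Z h D) := by
  have hi : Integrable (ℓ w) ((leafKernel Z h ∘ₖ child Z h) D) :=
    integrable_of_mem_Icc_zero_one (hℓ.comp measurable_prodMk_left) (hℓ01 w)
  exact Kernel.integral_comp hi

/-! ### Telescoping along the tree -/

theorem numNodes_succ (n : ℕ → ℕ) (l : ℕ) :
    numNodes n (l + 1) = n 0 * numNodes (fun k => n (k + 1)) l := by
  rw [numNodes, Finset.prod_range_succ', mul_comm]
  rfl

theorem sum_path_succ (n : ℕ → ℕ) (l : ℕ) (f : Path n (l + 1) → ℝ) :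
    ∑ i, f i = ∑ j : Fin (n 0), ∑ i : Path (fun k => n (k + 1)) l,
      f (Fin.cons (α := fun k : Fin (l + 1) => Fin (n k)) j i) := by
  rw [← Fintype.sum_prod_type']
  exact (Equiv.sum_comp (Fin.consEquiv fun k : Fin (l + 1) => Fin (n k)) f).symm

theorem empRisk_succ (ℓ : W → Z → ℝ) {L : ℕ} {n : ℕ → ℕ} (D : NodeSpace Z (L + 1)) (w : W)
    (t : Tree Z (L + 1) n) :
    empRisk ℓ D w t = (n 0 : ℝ)⁻¹ * ∑ j : Fin (n 0), empRisk ℓ (t j).1 w (t j).2 := by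
  rw [empRisk, numNodes_succ, sum_path_succ, Nat.cast_mul, mul_inv, mul_assoc, Finset.mul_sum]
  rfl

/-- The difference between the mean of the risk below a child of the parent of a node and the risk
below this node. -/
noncomputable def riskGap (ℓ : W → Z → ℝ) (L : ℕ) (n : ℕ → ℕ) (D : NodeSpace Z L) (w : W)
    (s : SuperTree Z L n) (l : Fin L) (i : Path n (l + 1)) : ℝ :=
  ∫ x, popRisk ℓ x w ∂((ghostKernel L n l i).1 (D, select L n s)) -
    popRisk ℓ (pick (entry L n l i s)) w

theorem riskGap_zero [MeasurableSpace W] {ℓ : W → Z → ℝ} (hℓ : Measurable (Function.uncurry ℓ))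
    (hℓ01 : ∀ w z, ℓ w z ∈ Set.Icc (0 : ℝ) 1) (L : ℕ) (n : ℕ → ℕ) (D : NodeSpace Z (L + 1)) (w : W)
    (s : SuperTree Z (L + 1) n) (i : Path n (0 + 1)) :
    riskGap ℓ (L + 1) n D w s 0 i = popRisk ℓ D w - popRisk ℓ (pick (s (i 0)).1) w := by
  rw [popRisk_succ hℓ hℓ01]
  rfl

/-- A telescoping sum, by induction on the depth: the terms of depth one replace the risk below the
root by the average risk below its selected children, and the remaining terms are the averages of
the same identities for the subtrees. At depth `0` the root is the only leaf and both sides vanish.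
-/
theorem popRisk_sub_empRisk [MeasurableSpace W] {ℓ : W → Z → ℝ}
    (hℓ : Measurable (Function.uncurry ℓ))
    (hℓ01 : ∀ w z, ℓ w z ∈ Set.Icc (0 : ℝ) 1) : (L : ℕ) → (n : ℕ → ℕ) → (∀ k < L, 0 < n k) →
    (D : NodeSpace Z L) → (w : W) → (s : SuperTree Z L n) →
    popRisk ℓ D w - empRisk ℓ D w (select L n s) =
      ∑ l : Fin L, (numNodes n (l + 1) : ℝ)⁻¹ * ∑ i : Path n (l + 1), riskGap ℓ L n D w s l i
  | 0, n, _, D, w, s => by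
    rw [popRisk_zero hℓ, empRisk]
    simp [numNodes, leaf]
  | L + 1, n, hn, D, w, s => by
    -- Needed for the average of the constant `popRisk ℓ D w` over the children to be that constant.
    have hn0 : (n 0 : ℝ) ≠ 0 := by exact_mod_cast (hn 0 L.succ_pos).ne'
    have h0 : (numNodes n ((0 : Fin (L + 1)) + 1) : ℝ)⁻¹ *
        ∑ i : Path n ((0 : Fin (L + 1)) + 1), riskGap ℓ (L + 1) n D w s 0 i =
        popRisk ℓ D w - (n 0 : ℝ)⁻¹ * ∑ j : Fin (n 0), popRisk ℓ (pick (s j).1) w := by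
      have h1 : ∑ i : Path n ((0 : Fin (L + 1)) + 1), riskGap ℓ (L + 1) n D w s 0 i =
          ∑ j : Fin (n 0), (popRisk ℓ D w - popRisk ℓ (pick (s j).1) w) := by
        refine (sum_path_succ n 0 _).trans (Finset.sum_congr rfl fun j _ => ?_)
        refine (Fintype.sum_unique _).trans ?_
        exact riskGap_zero hℓ hℓ01 L n D w s _
      rw [h1, Finset.sum_sub_distrib]
      have h2 : numNodes n ((0 : Fin (L + 1)) + 1) = n 0 := by simp [numNodes]
      rw [h2]
      simp [mul_sub, hn0]
    have hs : ∀ l : Fin L, (numNodes n (l.succ + 1) : ℝ)⁻¹ *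
        ∑ i : Path n (l.succ + 1), riskGap ℓ (L + 1) n D w s l.succ i =
        (n 0 : ℝ)⁻¹ * ∑ j : Fin (n 0), (numNodes (fun k => n (k + 1)) (l + 1) : ℝ)⁻¹ *
          ∑ i : Path (fun k => n (k + 1)) (l + 1),
            riskGap ℓ L (fun k => n (k + 1)) (pick (s j).1) w (s j).2 l i := by
      intro l
      have h1 : ∑ i : Path n (l.succ + 1), riskGap ℓ (L + 1) n D w s l.succ i =
          ∑ j : Fin (n 0), ∑ i : Path (fun k => n (k + 1)) (l + 1),
            riskGap ℓ L (fun k => n (k + 1)) (pick (s j).1) w (s j).2 l i :=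
        sum_path_succ n (l + 1) _
      have h2 : numNodes n (l.succ + 1) = n 0 * numNodes (fun k => n (k + 1)) (l + 1) :=
        numNodes_succ n (l + 1)
      rw [h1, h2, Nat.cast_mul, mul_inv, mul_assoc, Finset.mul_sum]
    rw [Fin.sum_univ_succ, h0]
    simp_rw [hs]
    rw [← Finset.mul_sum, Finset.sum_comm]
    have ih := fun j : Fin (n 0) => popRisk_sub_empRisk hℓ hℓ01 L (fun k => n (k + 1))
      (fun k hk => hn (k + 1) (Nat.succ_lt_succ hk)) (pick (s j).1) w (s j).2
    simp_rw [← ih]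
    rw [Finset.sum_sub_distrib, mul_sub, empRisk_succ]
    simp only [select]
    ring

variable [MeasurableSpace W]

/-! ### The mean risk gap at a node -/

theorem measurable_leaf : (L : ℕ) → (n : ℕ → ℕ) → (i : Path n L) →
    Measurable fun p : NodeSpace Z L × Tree Z L n => leaf L n p.1 p.2 i
  | 0, _, _ => measurable_fst
  | L + 1, n, i => (measurable_leaf L (fun k => n (k + 1)) fun k => i k.succ).comp
      ((measurable_pi_apply (i ⟨0, L.succ_pos⟩)).comp measurable_snd)

theorem measurable_empRisk {ℓ : W → Z → ℝ} (hℓ : Measurable (Function.uncurry ℓ)) {L : ℕ}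
    {n : ℕ → ℕ} (D : NodeSpace Z L) :
    Measurable fun p : Tree Z L n × W => empRisk ℓ D p.2 p.1 := by
  refine (Finset.measurable_fun_sum _ fun i _ => ?_).const_mul _
  exact hℓ.comp (measurable_snd.prodMk
    ((measurable_leaf L n i).comp (measurable_const.prodMk measurable_fst)))

theorem map_select_jointLaw {L : ℕ} {n : ℕ → ℕ} (D : NodeSpace Z L) (A : Kernel (Tree Z L n) W)
    [IsMarkovKernel A] :
    (jointLaw D A).map (fun ω => (select L n ω.1, ω.2)) = treeLaw L n D ⊗ₘ A := by
  have hs : Measurable (select (Z := Z) L n) := measurable_select L n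
  have hm : Measurable fun ω : SuperTree Z L n × W => (select L n ω.1, ω.2) := by fun_prop
  refine Measure.ext_of_lintegral _ fun F hF => ?_
  rw [lintegral_map hF hm, jointLaw, Measure.lintegral_compProd (by fun_prop),
    Measure.lintegral_compProd hF, ← map_select_superLaw,
    lintegral_map (Measurable.lintegral_kernel_prod_right' hF) hs]
  rfl

theorem genError_eq_integral_jointLaw {ℓ : W → Z → ℝ} (hℓ : Measurable (Function.uncurry ℓ)) {L : ℕ}
    {n : ℕ → ℕ} (D : NodeSpace Z L) (A : Kernel (Tree Z L n) W) [IsMarkovKernel A] :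
    genError ℓ D A =
      ∫ ω, (popRisk ℓ D ω.2 - empRisk ℓ D ω.2 (select L n ω.1)) ∂(jointLaw D A) := by
  have hs : Measurable (select (Z := Z) L n) := measurable_select L n
  rw [genError, ← map_select_jointLaw, integral_map (by fun_prop)]
  exact (((measurable_popRisk hℓ L).comp (measurable_const.prodMk measurable_snd)).sub
    (measurable_empRisk hℓ D)).aestronglyMeasurable

theorem measurable_integral_ghostKernel {L : ℕ} {n : ℕ → ℕ} (D : NodeSpace Z L)
    (l : Fin L) (i : Path n (l + 1)) {F : NodeSpace Z (height L l) × W → ℝ} (hF : Measurable F) :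
    Measurable fun p : Tree Z L n × W => ∫ x, F (x, p.2) ∂((ghostKernel L n l i).1 (D, p.1)) := by
  have : StronglyMeasurable fun q : (Tree Z L n × W) × NodeSpace Z (height L l) =>
      F (q.2, q.1.2) := (hF.comp (by fun_prop)).stronglyMeasurable
  exact (this.integral_kernel_prod_right' (κ := (ghostKernel L n l i).1.comap
    (fun p : Tree Z L n × W => (D, p.1)) (by fun_prop))).measurable

/-- The unselected candidate and the output of the algorithm are distributed like an independent
copy of the node, drawn from its parent, and the output of the algorithm. -/
theorem integral_unpick_jointLaw {L : ℕ} {n : ℕ → ℕ} (D : NodeSpace Z L)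
    (A : Kernel (Tree Z L n) W) [IsMarkovKernel A] (l : Fin L) (i : Path n (l + 1))
    {F : NodeSpace Z (height L l) × W → ℝ} (hF : Measurable F)
    (hF01 : ∀ p, F p ∈ Set.Icc (0 : ℝ) 1) :
    ∫ ω, F (unpick (entry L n l i ω.1), ω.2) ∂(jointLaw D A) =
      ∫ ω, ∫ x, F (x, ω.2) ∂((ghostKernel L n l i).1 (D, select L n ω.1)) ∂(jointLaw D A) := by
  have hs : Measurable (select (Z := Z) L n) := measurable_select L n
  have hu : Measurable fun s => unpick (entry (Z := Z) L n l i s) :=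
    measurable_unpick.comp (measurable_entry L n l i)
  set Q := treeLaw L n D ⊗ₘ
    (ghostKernel L n l i).1.comap (fun t => (D, t)) measurable_prodMk_left with hQ
  have hG : Measurable fun p : Tree Z L n × NodeSpace Z (height L l) =>
      ∫ w, F (p.2, w) ∂(A p.1) := by
    have : StronglyMeasurable fun q : (Tree Z L n × NodeSpace Z (height L l)) × W =>
      F (q.1.2, q.2) := (hF.comp (by fun_prop)).stronglyMeasurable
    exact (this.integral_kernel_prod_right' (κ := A.comap Prod.fst measurable_fst)).measurable
  have hFw : ∀ x, Measurable fun w => F (x, w) := fun x => hF.comp measurable_prodMk_left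
  have hFx : ∀ w, Measurable fun x => F (x, w) := fun w => hF.comp measurable_prodMk_right
  have hH := measurable_integral_ghostKernel D l i hF
  calc ∫ ω, F (unpick (entry L n l i ω.1), ω.2) ∂(jointLaw D A)
      = ∫ s, ∫ w, F (unpick (entry L n l i s), w) ∂(A (select L n s)) ∂(superLaw L n D) :=
        Measure.integral_compProd (integrable_of_mem_Icc_zero_one
          (hF.comp ((hu.comp measurable_fst).prodMk measurable_snd)) fun _ => hF01 _)
    -- The integrand depends on `s` only through the selected dataset and the unselected candidate.
    _ = ∫ p, ∫ w, F (p.2, w) ∂(A p.1) ∂Q := by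
        rw [hQ, ← map_select_unpick_superLaw L n l i D, integral_map (by fun_prop)
          hG.aestronglyMeasurable]
    _ = ∫ t, ∫ x, ∫ w, F (x, w) ∂(A t) ∂((ghostKernel L n l i).1 (D, t)) ∂(treeLaw L n D) :=
        Measure.integral_compProd (integrable_of_mem_Icc_zero_one hG
          fun p => integral_mem_Icc_zero_one (hFw _) fun _ => hF01 _)
    -- Given the dataset, the hypothesis and the fresh child are independent, so Fubini applies.
    _ = ∫ t, ∫ w, ∫ x, F (x, w) ∂((ghostKernel L n l i).1 (D, t)) ∂(A t) ∂(treeLaw L n D) := by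
        refine integral_congr_ae (ae_of_all _ fun t => ?_)
        exact integral_integral_swap (f := fun x w => F (x, w))
          (integrable_of_mem_Icc_zero_one hF hF01)
    _ = ∫ p, ∫ x, F (x, p.2) ∂((ghostKernel L n l i).1 (D, p.1)) ∂(treeLaw L n D ⊗ₘ A) :=
        (Measure.integral_compProd (integrable_of_mem_Icc_zero_one hH
          fun p => integral_mem_Icc_zero_one (hFx _) fun _ => hF01 _)).symm
    _ = _ := by
        rw [← map_select_jointLaw, integral_map (by fun_prop) hH.aestronglyMeasurable]

theorem integral_riskGap {ℓ : W → Z → ℝ} (hℓ : Measurable (Function.uncurry ℓ))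
    (hℓ01 : ∀ w z, ℓ w z ∈ Set.Icc (0 : ℝ) 1) {L : ℕ} {n : ℕ → ℕ} (D : NodeSpace Z L)
    (A : Kernel (Tree Z L n) W) [IsMarkovKernel A] (l : Fin L) (i : Path n (l + 1)) :
    Integrable (fun ω => riskGap ℓ L n D ω.2 ω.1 l i) (jointLaw D A) ∧
    ∫ ω, riskGap ℓ L n D ω.2 ω.1 l i ∂(jointLaw D A) =
      ∫ ω, (popRisk ℓ (unpick (entry L n l i ω.1)) ω.2 -
        popRisk ℓ (pick (entry L n l i ω.1)) ω.2) ∂(jointLaw D A) := by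
  have hs : Measurable (select (Z := Z) L n) := measurable_select L n
  have hp : Measurable fun s => pick (entry (Z := Z) L n l i s) :=
    measurable_pick.comp (measurable_entry L n l i)
  have hu : Measurable fun s => unpick (entry (Z := Z) L n l i s) :=
    measurable_unpick.comp (measurable_entry L n l i)
  have hF := measurable_popRisk hℓ (height L l)
  have hF01 : ∀ p : NodeSpace Z (height L l) × W, popRisk ℓ p.1 p.2 ∈ Set.Icc (0 : ℝ) 1 :=
    fun p => popRisk_mem_Icc hℓ hℓ01 p.1 p.2
  have h1 : Integrable (fun ω : SuperTree Z L n × W =>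
      ∫ x, popRisk ℓ x ω.2 ∂((ghostKernel L n l i).1 (D, select L n ω.1))) (jointLaw D A) :=
    integrable_of_mem_Icc_zero_one
      ((measurable_integral_ghostKernel D l i hF).comp
        ((hs.comp measurable_fst).prodMk measurable_snd))
      fun ω => integral_mem_Icc_zero_one (hF.comp measurable_prodMk_right) fun x => hF01 (x, ω.2)
  have h2 : Integrable (fun ω : SuperTree Z L n × W => popRisk ℓ (pick (entry L n l i ω.1)) ω.2)
      (jointLaw D A) :=
    integrable_of_mem_Icc_zero_one (hF.comp ((hp.comp measurable_fst).prodMk measurable_snd))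
      fun ω => hF01 (_, ω.2)
  have h3 : Integrable (fun ω : SuperTree Z L n × W => popRisk ℓ (unpick (entry L n l i ω.1)) ω.2)
      (jointLaw D A) :=
    integrable_of_mem_Icc_zero_one (hF.comp ((hu.comp measurable_fst).prodMk measurable_snd))
      fun ω => hF01 (_, ω.2)
  refine ⟨h1.sub h2, ?_⟩
  simp only [riskGap]
  rw [integral_sub h1 h2, integral_sub h3 h2, integral_unpick_jointLaw D A l i hF hF01]

/-! ### The information-theoretic bound at a node -/

theorem integral_coin (f : Fin 2 → ℝ) : ∫ u, f u ∂coin = 2⁻¹ * (f 0 + f 1) := by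
  rw [integral_fintype Integrable.of_finite]
  simp [Measure.real, coin_singleton, mul_add]

/-- Passing to the positive part only increases the integral. This lets the bound be applied for
each value of the pair separately. -/
theorem ofReal_integral_le_lintegral_ofReal {α : Type*} [MeasurableSpace α] {μ : Measure α}
    {f : α → ℝ} (hf : Integrable f μ) :
    ENNReal.ofReal (∫ a, f a ∂μ) ≤ ∫⁻ a, ENNReal.ofReal (f a) ∂μ := by
  refine (ENNReal.ofReal_le_ofReal
    (integral_mono hf hf.pos_part fun a => le_max_left _ _)).trans_eq ?_
  rw [ofReal_integral_eq_lintegral_ofReal hf.pos_part (ae_of_all _ fun a => le_max_right _ _)]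
  simp

theorem map_entry_jointLaw {L : ℕ} {n : ℕ → ℕ} (D : NodeSpace Z L) (A : Kernel (Tree Z L n) W)
    [IsMarkovKernel A] (l : Fin L) (i : Path n (l + 1)) :
    (jointLaw D A).map (fun ω => entry L n l i ω.1) =
      ((jointLaw D A).map fun ω => (entry L n l i ω.1).1).prod coin := by
  have he := measurable_entry (Z := Z) L n l i
  have h : (jointLaw D A).map Prod.fst = superLaw L n D := Measure.fst_compProd _ _
  have := map_entry_superLaw L n l i D
  rw [← h, Measure.map_map he measurable_fst, Measure.map_map he.fst measurable_fst] at this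
  exact this

theorem ofReal_integral_unpick_sub_pick_le_nodeTerm [StandardBorelSpace W] [Nonempty W]
    {ℓ : W → Z → ℝ} (hℓ : Measurable (Function.uncurry ℓ))
    (hℓ01 : ∀ w z, ℓ w z ∈ Set.Icc (0 : ℝ) 1) {L : ℕ} {n : ℕ → ℕ} (D : NodeSpace Z L)
    (A : Kernel (Tree Z L n) W) [IsMarkovKernel A] (l : Fin L) (i : Path n (l + 1)) :
    ENNReal.ofReal (∫ ω, (popRisk ℓ (unpick (entry L n l i ω.1)) ω.2 -
        popRisk ℓ (pick (entry L n l i ω.1)) ω.2) ∂(jointLaw D A)) ≤ nodeTerm D A l i := by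
  have he : Measurable fun ω : SuperTree Z L n × W => entry L n l i ω.1 :=
    (measurable_entry L n l i).comp measurable_fst
  set V : SuperTree Z L n × W → NodeSpace Z (height L l) × NodeSpace Z (height L l) :=
    fun ω => (entry L n l i ω.1).1 with hV
  set Y : SuperTree Z L n × W → Fin 2 := fun ω => (entry L n l i ω.1).2 with hY
  set X : SuperTree Z L n × W → W := fun ω => ω.2 with hX
  have hVm : Measurable V := he.fst
  have hYm : Measurable Y := he.snd
  have hXm : Measurable X := measurable_snd
  have := Measure.isProbabilityMeasure_map (μ := jointLaw D A) hVm.aemeasurable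
  set g : (NodeSpace Z (height L l) × NodeSpace Z (height L l)) × (W × Fin 2) → ℝ :=
    fun p => popRisk ℓ (unpick (p.1, p.2.2)) p.2.1 - popRisk ℓ (pick (p.1, p.2.2)) p.2.1 with hg
  have hF := measurable_popRisk hℓ (height L l)
  have hgm : Measurable g :=
    (hF.comp ((measurable_unpick.comp (by fun_prop : Measurable fun
      p : (NodeSpace Z (height L l) × NodeSpace Z (height L l)) × (W × Fin 2) =>
        (p.1, p.2.2))).prodMk (by fun_prop))).sub
    (hF.comp ((measurable_pick.comp (by fun_prop : Measurable fun
      p : (NodeSpace Z (height L l) × NodeSpace Z (height L l)) × (W × Fin 2) =>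
        (p.1, p.2.2))).prodMk (by fun_prop)))
  have hgb : ∀ p, g p ∈ Set.Icc (-1 : ℝ) 1 := by
    intro p
    have h1 := popRisk_mem_Icc hℓ hℓ01 (unpick (p.1, p.2.2)) p.2.1
    have h2 := popRisk_mem_Icc hℓ hℓ01 (pick (p.1, p.2.2)) p.2.1
    constructor <;> simp only [hg] <;> linarith [h1.1, h1.2, h2.1, h2.2]
  -- Independence of the selection variable and the pair, as a statement about the conditional law;
  -- it holds for almost every pair, which suffices under the integral.
  have hcoin : condDistrib Y V (jointLaw D A) =ᵐ[(jointLaw D A).map V] Kernel.const _ coin := by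
    refine condDistrib_ae_eq_of_measure_eq_compProd V hYm.aemeasurable ?_
    rw [Measure.compProd_const]
    exact map_entry_jointLaw D A l i
  have hdis : ∫ ω, g (V ω, (X ω, Y ω)) ∂(jointLaw D A) =
      ∫ c, ∫ q, g (c, q) ∂(condDistrib (fun ω => (X ω, Y ω)) V (jointLaw D A) c)
        ∂((jointLaw D A).map V) := by
    rw [← Measure.integral_compProd (Integrable.of_mem_Icc (-1) 1 hgm.aemeasurable
      (ae_of_all _ hgb)), compProd_map_condDistrib (hXm.prodMk hYm).aemeasurable,
      integral_map (by fun_prop) hgm.aestronglyMeasurable]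
  have hint : Integrable (fun c => ∫ q, g (c, q)
      ∂(condDistrib (fun ω => (X ω, Y ω)) V (jointLaw D A) c)) ((jointLaw D A).map V) :=
    Integrable.integral_compProd (Integrable.of_mem_Icc (-1) 1 hgm.aemeasurable
      (ae_of_all _ hgb) : Integrable g ((jointLaw D A).map V ⊗ₘ
        condDistrib (fun ω => (X ω, Y ω)) V (jointLaw D A)))
  refine (congrArg ENNReal.ofReal hdis).trans_le
    ((ofReal_integral_le_lintegral_ofReal hint).trans (lintegral_mono_ae ?_))
  filter_upwards [hcoin] with c hc
  refine ofReal_integral_le_sqrt_klDiv (hgm.comp measurable_prodMk_left) (fun q => hgb (c, q)) ?_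
  -- For each fixed hypothesis the two values of the selection variable give opposite values of `g`,
  -- so the centring holds whatever the conditional law of `W` is.
  rw [hc, Kernel.const_apply, integral_prod (fun q => g (c, q)) (Integrable.of_mem_Icc (-1) 1
    (hgm.comp measurable_prodMk_left).aemeasurable (ae_of_all _ fun q => hgb (c, q)))]
  simp [integral_coin, hg, pick, unpick]

theorem numNodes_pos {n : ℕ → ℕ} {l : ℕ} (hn : ∀ k < l, 0 < n k) : 0 < numNodes n l :=
  Finset.prod_pos fun k hk => hn k (Finset.mem_range.1 hk)

end HierFL

theorem mainTheorem2 {Z : Type*} [MeasurableSpace Z] {W : Type*} [MeasurableSpace W]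
    [StandardBorelSpace W] [Nonempty W] (L : ℕ) (n : ℕ → ℕ) (hn : ∀ k < L, 0 < n k)
    (D : HierFL.NodeSpace Z L) (ℓ : W → Z → ℝ) (hℓ : Measurable (Function.uncurry ℓ))
    (hℓ01 : ∀ w z, ℓ w z ∈ Set.Icc (0 : ℝ) 1)
    (A : Kernel (HierFL.Tree Z L n) W) [IsMarkovKernel A] :
    ENNReal.ofReal (HierFL.genError ℓ D A) ≤
      ∑ l : Fin L, (HierFL.numNodes n (l + 1) : ℝ≥0∞)⁻¹ *
        ∑ i : HierFL.Path n (l + 1), HierFL.nodeTerm D A l i := by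
  have hgap := fun (l : Fin L) (i : HierFL.Path n (l + 1)) =>
    HierFL.integral_riskGap hℓ hℓ01 D A l i
  have hsum : ∀ {ι : Type} (s : Finset ι) (f : ι → ℝ),
      ENNReal.ofReal (∑ j ∈ s, f j) ≤ ∑ j ∈ s, ENNReal.ofReal (f j) := fun s f =>
    Finset.le_sum_of_subadditive ENNReal.ofReal ENNReal.ofReal_zero.le
      (fun _ _ => ENNReal.ofReal_add_le) s f
  rw [HierFL.genError_eq_integral_jointLaw hℓ]
  simp_rw [HierFL.popRisk_sub_empRisk hℓ hℓ01 L n hn D]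
  rw [integral_finsetSum _ fun l _ => (integrable_finsetSum _ fun i _ =>
    (hgap l i).1).const_mul _]
  -- The terms are real numbers of either sign; `ENNReal.ofReal` truncates at zero and is
  -- subadditive.
  refine (hsum _ _).trans (Finset.sum_le_sum fun l _ => ?_)
  have hN : 0 < HierFL.numNodes n (l + 1) :=
    HierFL.numNodes_pos fun k hk => hn k (hk.trans_le l.2)
  rw [integral_const_mul, ENNReal.ofReal_mul (by positivity),
    ENNReal.ofReal_inv_of_pos (by exact_mod_cast hN), ENNReal.ofReal_natCast,
    integral_finsetSum _ fun i _ => (hgap l i).1]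
  gcongr
  refine (hsum _ _).trans (Finset.sum_le_sum fun i _ => ?_)
  rw [(hgap l i).2]
  exact HierFL.ofReal_integral_unpick_sub_pick_le_nodeTerm hℓ hℓ01 D A l i
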